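/- Let $p$ be a prime, let $\mathbb{C}_p$ carry the absolute value with $|p|=1/p$, and let $\mathcal{O}_p$ be its closed unit disk. Write $D_r(0)$ and $\overline{D}_r(0)$ for the open and closed disks of radius $r$ about $0$ in $\mathbb{C}_p$. Let $\lambda\in\mathbb{C}_p$ with $|\lambda|=1$ be not a root of unity. Let $\Gamma_r$ be the group of roots of unity in $\mathbb{C}_p$ whose order is a power of $p$, and put $R(0)=0$ and $R(j)=p^{-1/(p^{j-1}(p-1))}$ for $j\ge 1$. Then there exist an integer $m\ge1$, integers $s,t\geq 0$ and $\gamma_0\in\Gamma_r$ such that $m$ is the least integer $n\geq1$ with $|1-\lambda^n|<1$, $R(s)\le|1-\lambda^m|<R(s+1)$, $\gamma_0$ minimizes $|\gamma-\lambda^m|$ over $\gamma\in\Gamma_r$, and $R(t)\le|\gamma_0-\lambda^m|<R(t+1)$. For any such $m,s,t,\gamma_0$ put $$\tilde r(\lambda)=R(s+1)^{\frac1m}\,p^{-\frac{s-t}{mp^s}}\,|1-\lambda^m|^{\frac{s(p-1)}{mp}}\,|\gamma_0-\lambda^m|^{\frac{1}{mp^{s-t}}}.$$ Let $f\in\mathcal{G}_\lambda=\lambda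 x+x^2\mathcal{O}_p[[x]]$. There is a unique formal power series $H_f\in\mathbb{C}_p[[x]]$ with $H_f(0)=0$, $H_f'(0)=1$ and $H_f\circ f=\lambda H_f$. Let $\Delta_f$ be the linearization disk of $f$, i.e. the maximal disk about $0$ on which $f$ is analytically conjugate to $x\mapsto\lambda x$ (the union of all open or closed disks $D$ about $0$ such that $f$ converges on $D$, maps $D$ into itself, and is conjugate on $D$ to $x\mapsto \lambda x$ by a power series that converges on $D$ and maps $D$ bijectively onto a disk about $0$), and let $r(f)\in[0,\infty]$ be its radius. Then $r(f)\geq\tilde r(\lambda)$; more precisely $\Delta_f\supseteq D_{\tilde r(\lambda)}(0)$. Moreover, if $H_f$ converges on the closed disk $\overline{D}_{\tilde r(\lambda)}(0)$, then $\Delta_f\supseteq\overline{D}_{\tilde r(\lambda)}(0)$. -/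

import Mathlib

open scoped ENNReal PowerSeries

namespace PadicLin

/-- The power series `f` converges at the point `x` of `ℂ_p`. -/
def ConvergesAt {p : ℕ} [Fact p.Prime] (f : ℂ_[p]⟦X⟧) (x : ℂ_[p]) : Prop :=
  Summable fun n : ℕ => PowerSeries.coeff n f * x ^ n

/-- The value at `x` of the sum of the power series `f` (used only at points of convergence). -/
noncomputable def value {p : ℕ} [Fact p.Prime] (f : ℂ_[p]⟦X⟧) (x : ℂ_[p]) : ℂ_[p] :=
  ∑' n : ℕ, PowerSeries.coeff n f * x ^ n

/-- The family `𝒢_λ = λ x + x² 𝒪_p[[x]]`, where `𝒪_p` is the closed unit disk of `ℂ_p`. -/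
def GFamily {p : ℕ} [Fact p.Prime] (lam : ℂ_[p]) : Set ℂ_[p]⟦X⟧ :=
  {f | PowerSeries.coeff 0 f = 0 ∧ PowerSeries.coeff 1 f = lam ∧
    ∀ i : ℕ, 2 ≤ i → ‖PowerSeries.coeff i f‖ ≤ 1}

/-- `H` is a normalized formal conjugacy of `f` to `x ↦ λ x`:
`H(0) = 0`, `H'(0) = 1` and `H ∘ f = λ H` as formal power series. -/
def IsConjugacy {p : ℕ} [Fact p.Prime] (f : ℂ_[p]⟦X⟧) (lam : ℂ_[p]) (H : ℂ_[p]⟦X⟧) : Prop :=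
  PowerSeries.coeff 0 H = 0 ∧ PowerSeries.coeff 1 H = 1 ∧ H.subst f = lam • H

/-- Open and closed disks of positive radius about the origin of `ℂ_p`. -/
def IsDisk {p : ℕ} [Fact p.Prime] (D : Set ℂ_[p]) : Prop :=
  ∃ r : ℝ, 0 < r ∧ (D = Metric.ball 0 r ∨ D = Metric.closedBall 0 r)

/-- On the set `D`, the series `f` is analytically conjugate to `T_λ : x ↦ λ x`: `f` converges on
`D` and maps `D` into itself, and some power series `h` converging on `D` is a bijection of `D`
onto a disk `D'` about the origin with `h ∘ f = T_λ ∘ h` on `D`. -/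
def IsAnalyticallyConjugateOn {p : ℕ} [Fact p.Prime] (f : ℂ_[p]⟦X⟧) (lam : ℂ_[p])
    (D : Set ℂ_[p]) : Prop :=
  (∀ x ∈ D, ConvergesAt f x) ∧ Set.MapsTo (value f) D D ∧
    ∃ (h : ℂ_[p]⟦X⟧) (D' : Set ℂ_[p]), IsDisk D' ∧ (∀ x ∈ D, ConvergesAt h x) ∧
      Set.BijOn (value h) D D' ∧ ∀ x ∈ D, value h (value f x) = lam * value h x

/-- The linearization disk `Δ_f`: the maximal disk about the origin on which `f` is analytically
conjugate to `T_λ`. The disks about the origin form a chain, and so the maximal one is the union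
of all those on which `f` is conjugate to `T_λ` (this is all of `ℂ_p` for `f = λ x`). -/
def linearizationDisk {p : ℕ} [Fact p.Prime] (f : ℂ_[p]⟦X⟧) (lam : ℂ_[p]) : Set ℂ_[p] :=
  ⋃₀ {D | IsDisk D ∧ IsAnalyticallyConjugateOn f lam D}

/-- The radius `r(f) ∈ [0, ∞]` of the linearization disk. -/
noncomputable def linearizationRadius {p : ℕ} [Fact p.Prime] (f : ℂ_[p]⟦X⟧) (lam : ℂ_[p]) :
    ℝ≥0∞ :=
  sSup {ρ | ∃ r : ℝ, 0 < r ∧ Metric.ball (0 : ℂ_[p]) r ⊆ linearizationDisk f lam ∧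
    ρ = ENNReal.ofReal r}

/-- `R(0) = 0` and `R(s) = p ^ (-1 / (p ^ (s - 1) (p - 1)))` for `s ≥ 1`. -/
noncomputable def R (p : ℕ) : ℕ → ℝ
  | 0 => 0
  | s + 1 => (p : ℝ) ^ (-(1 / ((p : ℝ) ^ s * ((p : ℝ) - 1))))

/-- The group `Γ_r` of the roots of unity in `ℂ_p` of order a power of `p`. -/
def GammaR (p : ℕ) [Fact p.Prime] : Set ℂ_[p] :=
  {ζ | ∃ j : ℕ, ζ ^ p ^ j = 1}

/-- The quantities `m`, `s`, `t`, `γ₀` attached to the multiplier `λ`. -/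
structure IsMultiplierData {p : ℕ} [Fact p.Prime] (lam : ℂ_[p]) (m s t : ℕ) (γ₀ : ℂ_[p]) :
    Prop where
  /-- `m` is the least `n ≥ 1` with `|1 - λ ^ n| < 1`. -/
  m_least : IsLeast {n : ℕ | 1 ≤ n ∧ ‖1 - lam ^ n‖ < 1} m
  /-- `R(s) ≤ |1 - λ ^ m| < R(s + 1)`. -/
  s_bounds : R p s ≤ ‖1 - lam ^ m‖ ∧ ‖1 - lam ^ m‖ < R p (s + 1)
  /-- `γ₀ ∈ Γ_r`. -/
  γ₀_mem : γ₀ ∈ GammaR p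
  /-- `γ₀` minimizes the distance to `λ ^ m` over `Γ_r`. -/
  γ₀_min : ∀ γ ∈ GammaR p, ‖γ₀ - lam ^ m‖ ≤ ‖γ - lam ^ m‖
  /-- `R(t) ≤ |γ₀ - λ ^ m| < R(t + 1)`. -/
  t_bounds : R p t ≤ ‖γ₀ - lam ^ m‖ ∧ ‖γ₀ - lam ^ m‖ < R p (t + 1)

/-- The lower bound
`R(s+1)^(1/m) * p^(-(s-t)/(m p^s)) * |1-λ^m|^(s (p-1)/(m p)) * |γ₀-λ^m|^(1/(m p^(s-t)))`. -/
noncomputable def rTilde {p : ℕ} [Fact p.Prime] (lam : ℂ_[p]) (m s t : ℕ) (γ₀ : ℂ_[p]) : ℝ :=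
  R p (s + 1) ^ (1 / (m : ℝ)) *
    (p : ℝ) ^ (-(((s : ℝ) - (t : ℝ)) / ((m : ℝ) * (p : ℝ) ^ s))) *
    ‖1 - lam ^ m‖ ^ ((s : ℝ) * (((p : ℝ) - 1) / ((m : ℝ) * (p : ℝ)))) *
    ‖γ₀ - lam ^ m‖ ^ (1 / ((m : ℝ) * (p : ℝ) ^ ((s : ℝ) - (t : ℝ))))

end PadicLin

/-! Comparing coefficients in `H ∘ f = λ H` expresses `b_k (λ - λ^k)` through the earlier `b_l` with
integral weights. Hence `H` exists uniquely, and by the ultrametric inequality `|b_{k+1}| ∏_{n=1}^k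
|1 - λ^n| ≤ 1` (`norm_coeff_conjugacy_mul_prod_le`). Everything rests on bounding these small
divisors from below.

Only multiples of `m` give divisors of norm below 1. For `n = m a`, with `μ = λ^m`, the part of `a`
prime to `p` does not shrink the divisor, so only `|1 - μ^(p^j)|` with `j = v_p(a)` matters. Factor
it over the `p^j`-th roots of unity. If `j < s`, these roots are all closer to 1 than `μ` is, so `|1
- μ|^(p^j)` is a lower bound. If `j ≥ s`, divide by `γ₀` and start at level `t`; each further level
costs at most a factor `|Φ_{p^(j+1)}(1)| = 1/p`.

The resulting exponents increase with `j`. Summing them over `a ≤ N` by counting multiples of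
`p^(j+1)` gives a total strictly below `N W`, where `r̃ = p^(-W/m)`. So `|b_k| r̃^(k-1) < 1` for
every `k ≥ 2` (`norm_coeff_mul_rTilde_pow_lt`).

On a smaller radius these terms are bounded away from 1; on the circle of radius `r̃` this still
holds if `H` converges there, since the terms then tend to 0. The higher part of `H` is then a
contraction, so `H` maps the disk bijectively onto itself (`bijOn_tsum`) and conjugates `f` to
multiplication by `λ`. -/

namespace PadicLin

/-! ### Ultrametric power series: composition and bijectivity on disks. -/

section PowerSeriesLemmas

variable {K : Type*} [NormedField K]

theorem coeff_pow_eq_zero_of_lt {f : K⟦X⟧} (h0 : PowerSeries.coeff 0 f = 0) {k l : ℕ}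
    (hkl : k < l) : PowerSeries.coeff k (f ^ l) = 0 := by
  have hX : (PowerSeries.X : K⟦X⟧) ∣ f := by
    rw [PowerSeries.X_dvd_iff]; simpa using h0
  exact PowerSeries.X_pow_dvd_iff.mp (pow_dvd_pow_of_dvd hX l) k hkl

theorem coeff_pow_self {f : K⟦X⟧} (h0 : PowerSeries.coeff 0 f = 0) (l : ℕ) :
    PowerSeries.coeff l (f ^ l) = PowerSeries.coeff 1 f ^ l := by
  have hX : (PowerSeries.X : K⟦X⟧) ∣ f := by
    rw [PowerSeries.X_dvd_iff]; simpa using h0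
  obtain ⟨g, rfl⟩ := hX
  have h := PowerSeries.coeff_X_pow_mul (g ^ l) l 0
  have h1 := PowerSeries.coeff_succ_X_mul 0 g
  rw [zero_add] at h h1
  rw [mul_pow, h, h1]
  simp

theorem norm_coeff_mul_le_one [IsUltrametricDist K] {f g : K⟦X⟧}
    (hf : ∀ k, ‖PowerSeries.coeff k f‖ ≤ 1) (hg : ∀ k, ‖PowerSeries.coeff k g‖ ≤ 1) (k : ℕ) :
    ‖PowerSeries.coeff k (f * g)‖ ≤ 1 := by
  rw [PowerSeries.coeff_mul]
  refine IsUltrametricDist.norm_sum_le_of_forall_le_of_nonneg zero_le_one fun i _ => ?_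
  rw [norm_mul]
  exact mul_le_one₀ (hf _) (norm_nonneg _) (hg _)

theorem norm_coeff_pow_le_one [IsUltrametricDist K] {f : K⟦X⟧}
    (hf : ∀ k, ‖PowerSeries.coeff k f‖ ≤ 1) (l k : ℕ) :
    ‖PowerSeries.coeff k (f ^ l)‖ ≤ 1 := by
  induction l generalizing k with
  | zero =>
    rw [pow_zero, PowerSeries.coeff_one]
    split_ifs <;> simp
  | succ l ih =>
    rw [pow_succ]
    exact norm_coeff_mul_le_one ih hf k

theorem summable_norm_coeff_mul_pow {f : K⟦X⟧} (hf : ∀ k, ‖PowerSeries.coeff k f‖ ≤ 1) {x : K}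
    (hx : ‖x‖ < 1) : Summable fun n : ℕ => ‖PowerSeries.coeff n f * x ^ n‖ := by
  refine Summable.of_nonneg_of_le (fun _ => norm_nonneg _) (fun n => ?_)
    (summable_geometric_of_lt_one (norm_nonneg x) hx)
  rw [norm_mul, norm_pow]
  exact mul_le_of_le_one_left (by positivity) (hf n)

theorem tsum_coeff_pow [IsUltrametricDist K] [CompleteSpace K] {f : K⟦X⟧}
    (hf : ∀ k, ‖PowerSeries.coeff k f‖ ≤ 1) {x : K} (hx : ‖x‖ < 1) (l : ℕ) :
    ∑' n : ℕ, PowerSeries.coeff n (f ^ l) * x ^ n =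
      (∑' n : ℕ, PowerSeries.coeff n f * x ^ n) ^ l := by
  induction l with
  | zero =>
    rw [pow_zero, pow_zero, tsum_eq_single 0]
    · simp
    · intro n hn
      simp [PowerSeries.coeff_one, hn]
  | succ l ih =>
    rw [pow_succ, pow_succ, ← ih, tsum_mul_tsum_eq_tsum_sum_antidiagonal_of_summable_norm
      (summable_norm_coeff_mul_pow (norm_coeff_pow_le_one hf l) hx)
      (summable_norm_coeff_mul_pow hf hx)]
    refine tsum_congr fun n => ?_
    rw [PowerSeries.coeff_mul, Finset.sum_mul]
    refine Finset.sum_congr rfl fun i hi => ?_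
    rw [← Finset.HasAntidiagonal.mem_antidiagonal.mp hi, pow_add]
    ring

theorem norm_sub_le_max [IsUltrametricDist K] (x y : K) : ‖x - y‖ ≤ max ‖x‖ ‖y‖ := by
  rw [sub_eq_add_neg, ← norm_neg y]
  exact IsUltrametricDist.norm_add_le_max _ _

theorem norm_pow_sub_pow_le [IsUltrametricDist K] {x y : K} (hxy : ‖y‖ ≤ ‖x‖) (n : ℕ) :
    ‖x ^ (n + 1) - y ^ (n + 1)‖ ≤ ‖x‖ ^ n * ‖x - y‖ := by
  rw [← (Commute.all x y).geom_sum₂_mul, norm_mul]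
  refine mul_le_mul_of_nonneg_right ?_ (norm_nonneg _)
  refine IsUltrametricDist.norm_sum_le_of_forall_le_of_nonneg (by positivity) fun i hi => ?_
  rw [norm_mul, norm_pow, norm_pow]
  have hi' : i ≤ n := Nat.lt_succ_iff.mp (Finset.mem_range.mp hi)
  calc ‖x‖ ^ i * ‖y‖ ^ (n + 1 - 1 - i) ≤ ‖x‖ ^ i * ‖x‖ ^ (n + 1 - 1 - i) := by gcongr
    _ = ‖x‖ ^ n := by rw [← pow_add]; congr 1; omega

theorem summable_comp [IsUltrametricDist K] [CompleteSpace K] {f : K⟦X⟧}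
    (h0 : PowerSeries.coeff 0 f = 0) (hf : ∀ k, ‖PowerSeries.coeff k f‖ ≤ 1) {b : ℕ → K} {x : K}
    (hx : ‖x‖ < 1) (hb : Summable fun n => b n * x ^ n) :
    Summable fun q : ℕ × ℕ => b q.1 * (PowerSeries.coeff q.2 (f ^ q.1) * x ^ q.2) := by
  -- Since `f^l` starts in degree `l`, only pairs `(l, l + i)` matter; there the terms are dominated
  -- by the product family `b_l x^l · x^i`.
  have hinj : Function.Injective fun q : ℕ × ℕ => (q.1, q.1 + q.2) := by
    rintro ⟨a, c⟩ ⟨a', c'⟩ h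
    simp only [Prod.mk.injEq] at h ⊢
    omega
  rw [← hinj.summable_iff]
  · have : NonarchimedeanRing K :=
      { is_nonarchimedean := NonarchimedeanAddGroup.is_nonarchimedean }
    have hgeom : Summable fun n : ℕ => x ^ n := summable_geometric_of_norm_lt_one hx
    have hprod := (hb.mul_of_nonarchimedean hgeom).tendsto_cofinite_zero
    refine NonarchimedeanAddGroup.summable_of_tendsto_cofinite_zero ?_
    rw [tendsto_zero_iff_norm_tendsto_zero] at hprod ⊢
    refine squeeze_zero (fun _ => norm_nonneg _) (fun q => ?_) hprod
    have h1 := norm_coeff_pow_le_one hf q.1 (q.1 + q.2)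
    have h2 : ‖b q.1 * x ^ q.1 * x ^ q.2‖ = ‖b q.1‖ * (1 * (‖x‖ ^ q.1 * ‖x‖ ^ q.2)) := by
      rw [norm_mul, norm_mul, norm_pow, norm_pow]; ring
    rw [h2, Function.comp_apply, norm_mul, norm_mul, norm_pow, pow_add]
    gcongr
  · rintro ⟨l, k⟩ hq
    have hkl : k < l := by
      by_contra! h
      exact hq ⟨(l, k - l), by simp only [Prod.mk.injEq, true_and]; omega⟩
    simp [coeff_pow_eq_zero_of_lt h0 hkl]

/-- Composition of sums of series with a series with integral coefficients. -/
theorem tsum_comp [IsUltrametricDist K] [CompleteSpace K] {f : K⟦X⟧}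
    (h0 : PowerSeries.coeff 0 f = 0) (hf : ∀ k, ‖PowerSeries.coeff k f‖ ≤ 1) {b : ℕ → K} {x : K}
    (hx : ‖x‖ < 1) (hb : Summable fun n => b n * x ^ n) :
    ∑' n : ℕ, b n * (∑' k : ℕ, PowerSeries.coeff k f * x ^ k) ^ n =
      ∑' k : ℕ, (∑ l ∈ Finset.range (k + 1), b l * PowerSeries.coeff k (f ^ l)) * x ^ k := by
  have h1 (n : ℕ) : b n * (∑' k : ℕ, PowerSeries.coeff k f * x ^ k) ^ n =
      ∑' k : ℕ, b n * (PowerSeries.coeff k (f ^ n) * x ^ k) := by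
    rw [← tsum_coeff_pow hf hx, ← tsum_mul_left]
  have h2 (k : ℕ) : ∑' n : ℕ, b n * (PowerSeries.coeff k (f ^ n) * x ^ k) =
      (∑ l ∈ Finset.range (k + 1), b l * PowerSeries.coeff k (f ^ l)) * x ^ k := by
    rw [tsum_eq_sum (s := Finset.range (k + 1)), Finset.sum_mul]
    · exact Finset.sum_congr rfl fun l _ => (mul_assoc _ _ _).symm
    · intro l hl
      have hkl : k < l := by simpa using hl
      rw [coeff_pow_eq_zero_of_lt h0 hkl, zero_mul, mul_zero]
  rw [tsum_congr h1, ← tsum_congr h2]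
  exact (Summable.tsum_comm
    (f := fun n k => b n * (PowerSeries.coeff k (f ^ n) * x ^ k)) (summable_comp h0 hf hx hb)).symm

/-- A series tangent to the identity, with small higher terms on a disk `D`, is a bijection of
`D` onto itself. -/
theorem bijOn_tsum [IsUltrametricDist K] [CompleteSpace K] {b : ℕ → K} (hb0 : b 0 = 0)
    (hb1 : b 1 = 1) {D : Set K} (hD : ∀ x ∈ D, ∀ y, ‖y‖ ≤ ‖x‖ → y ∈ D)
    (hsum : ∀ x ∈ D, Summable fun n => b n * x ^ n)
    (hc : ∀ x ∈ D, ∃ c < 1, ∀ k, ‖b (k + 2)‖ * ‖x‖ ^ (k + 1) ≤ c) :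
    Set.BijOn (fun x => ∑' n, b n * x ^ n) D D := by
  set E : K → K := fun x => ∑' n, b (n + 2) * x ^ (n + 2) with hE
  have hsplit : ∀ x ∈ D, ∑' n, b n * x ^ n = x + E x := by
    intro x hx
    rw [← (hsum x hx).sum_add_tsum_nat_add 2]
    simp [Finset.sum_range_succ, hb0, hb1, hE]
  have hsumE : ∀ x ∈ D, Summable fun n => b (n + 2) * x ^ (n + 2) := fun x hx =>
    (summable_nat_add_iff (f := fun n => b n * x ^ n) 2).mpr (hsum x hx)
  have hE0 : E 0 = 0 := by simp [hE]
  -- The Lipschitz constant may depend on `‖z‖`: on an open disk no constant below 1 need serve all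
  -- radii at once.
  have hlip : ∀ z ∈ D, ∃ c : ℝ, 0 ≤ c ∧ c < 1 ∧ ∀ x y, ‖x‖ ≤ ‖z‖ → ‖y‖ ≤ ‖z‖ →
      ‖E x - E y‖ ≤ c * ‖x - y‖ := by
    intro z hz
    obtain ⟨c, hc1, hcz⟩ := hc z hz
    refine ⟨max c 0, le_max_right _ _, max_lt hc1 one_pos, ?_⟩
    have key : ∀ x y, ‖x‖ ≤ ‖z‖ → ‖y‖ ≤ ‖x‖ → ‖E x - E y‖ ≤ max c 0 * ‖x - y‖ := by
      intro x y hx hy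
      have hxD := hD z hz x hx
      have hyD := hD x hxD y hy
      rw [hE]
      dsimp only
      rw [← (hsumE x hxD).tsum_sub (hsumE y hyD)]
      refine IsUltrametricDist.norm_tsum_le_of_forall_le_of_nonneg (by positivity) fun k => ?_
      rw [← mul_sub, norm_mul]
      calc ‖b (k + 2)‖ * ‖x ^ (k + 2) - y ^ (k + 2)‖
          ≤ ‖b (k + 2)‖ * (‖x‖ ^ (k + 1) * ‖x - y‖) := by
            gcongr; exact norm_pow_sub_pow_le hy (k + 1)
        _ ≤ ‖b (k + 2)‖ * (‖z‖ ^ (k + 1) * ‖x - y‖) := by gcongr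
        _ = (‖b (k + 2)‖ * ‖z‖ ^ (k + 1)) * ‖x - y‖ := by ring
        _ ≤ max c 0 * ‖x - y‖ := by
            gcongr; exact (hcz k).trans (le_max_left _ _)
    intro x y hx hy
    rcases le_total ‖y‖ ‖x‖ with h | h
    · exact key x y hx h
    · rw [norm_sub_rev, norm_sub_rev x y]
      exact key y x hy h
  have hEle : ∀ z ∈ D, ∀ x, ‖x‖ ≤ ‖z‖ → ‖E x‖ ≤ ‖z‖ := by
    intro z hz x hx
    obtain ⟨c, hc0, hc1, hcz⟩ := hlip z hz
    have h := hcz x 0 hx (by simp)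
    rw [hE0, sub_zero, sub_zero] at h
    exact h.trans ((mul_le_of_le_one_left (norm_nonneg _) hc1.le).trans hx)
  refine ⟨fun x hx => ?_, fun x hx y hy hxy => ?_, fun y hy => ?_⟩
  · refine hD x hx _ ?_
    dsimp only
    rw [hsplit x hx]
    exact (IsUltrametricDist.norm_add_le_max _ _).trans (max_le le_rfl (hEle x hx x le_rfl))
  · dsimp only at hxy
    rw [hsplit x hx, hsplit y hy] at hxy
    have key : ∀ z ∈ D, ‖x‖ ≤ ‖z‖ → ‖y‖ ≤ ‖z‖ → x = y := by
      intro z hz hxz hyz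
      obtain ⟨c, hc0, hc1, hcz⟩ := hlip z hz
      have h := hcz x y hxz hyz
      have h2 : E x - E y = -(x - y) := by linear_combination hxy
      rw [h2, norm_neg] at h
      by_contra hne
      have hpos : 0 < ‖x - y‖ := norm_pos_iff.mpr (sub_ne_zero.mpr hne)
      nlinarith
    rcases le_total ‖y‖ ‖x‖ with h | h
    · exact key x hx le_rfl h
    · exact key y hy h le_rfl
  · obtain ⟨c, hc0, hc1, hcz⟩ := hlip y hy
    have hcomp : IsComplete (Metric.closedBall (0 : K) ‖y‖) := Metric.isClosed_closedBall.isComplete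
    -- Solving `z + E z = y` is finding a fixed point of `z ↦ y - E z`, a contraction of the closed
    -- ball of radius `‖y‖`.
    have hmaps : Set.MapsTo (fun z => y - E z) (Metric.closedBall (0 : K) ‖y‖)
        (Metric.closedBall (0 : K) ‖y‖) := by
      intro z hz
      rw [mem_closedBall_zero_iff] at hz ⊢
      exact (norm_sub_le_max _ _).trans (max_le le_rfl (hEle y hy z hz))
    have hcontr : ContractingWith ⟨c, hc0⟩ (hmaps.restrict _ _ _) := by
      refine ⟨by exact_mod_cast hc1, LipschitzWith.of_dist_le_mul ?_⟩
      rintro ⟨u, hu⟩ ⟨v, hv⟩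
      rw [mem_closedBall_zero_iff] at hu hv
      rw [Subtype.dist_eq, Subtype.dist_eq, dist_eq_norm, dist_eq_norm]
      have h := hcz v u hv hu
      simp only [Set.MapsTo.val_restrict_apply, sub_sub_sub_cancel_left]
      rwa [norm_sub_rev u v]
    obtain ⟨z, hz, hfix, -⟩ := hcontr.exists_fixedPoint' hcomp hmaps
      (mem_closedBall_zero_iff.mpr le_rfl) (edist_ne_top _ _)
    rw [mem_closedBall_zero_iff] at hz
    have hzD := hD y hy z hz
    refine ⟨z, hzD, ?_⟩
    dsimp only
    rw [hsplit z hzD]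
    have : y - E z = z := hfix
    linear_combination -this

end PowerSeriesLemmas

/-! ### The formal conjugacy, its coefficient bound and its analytic meaning. -/

section Conjugacy

variable {p : ℕ} [Fact p.Prime] {lam : ℂ_[p]} {f : ℂ_[p]⟦X⟧}

theorem GFamily.norm_coeff_le_one (hlam : ‖lam‖ = 1) (hf : f ∈ GFamily lam) (k : ℕ) :
    ‖PowerSeries.coeff k f‖ ≤ 1 := by
  obtain ⟨h0, h1, h2⟩ := hf
  rcases k with _ | _ | k
  · simp [h0]
  · rw [zero_add, h1, hlam]
  · exact h2 _ (by omega)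

theorem coeff_subst_eq_sum (h0 : PowerSeries.coeff 0 f = 0) (H : ℂ_[p]⟦X⟧) (k : ℕ) :
    PowerSeries.coeff k (H.subst f) =
      ∑ l ∈ Finset.range (k + 1), PowerSeries.coeff l H * PowerSeries.coeff k (f ^ l) := by
  have hs : PowerSeries.HasSubst f := PowerSeries.HasSubst.of_constantCoeff_zero' (by simpa using h0)
  rw [PowerSeries.coeff_subst' hs]
  rw [finsum_eq_sum_of_support_subset (s := Finset.range (k + 1))]
  · simp only [smul_eq_mul]
  · intro l hl
    by_contra hlk
    have hkl : k < l := by simpa using hlk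
    refine hl ?_
    dsimp only
    rw [coeff_pow_eq_zero_of_lt h0 hkl, smul_zero]

theorem subst_eq_smul_iff (h0 : PowerSeries.coeff 0 f = 0) (H : ℂ_[p]⟦X⟧) :
    H.subst f = lam • H ↔ ∀ k,
      ∑ l ∈ Finset.range (k + 1), PowerSeries.coeff l H * PowerSeries.coeff k (f ^ l) =
        lam * PowerSeries.coeff k H := by
  rw [PowerSeries.ext_iff]
  simp only [coeff_subst_eq_sum h0, PowerSeries.coeff_smul]
  exact Iff.rfl

/-- The diagonal coefficient of `f^k` is `λ^k`; moving it to the other side turns the functional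
equation into a recursion. -/
theorem isConjugacy_iff (hf : f ∈ GFamily lam) (H : ℂ_[p]⟦X⟧) :
    IsConjugacy f lam H ↔ PowerSeries.coeff 0 H = 0 ∧ PowerSeries.coeff 1 H = 1 ∧
      ∀ k, 2 ≤ k → PowerSeries.coeff k H * (lam - lam ^ k) =
        ∑ l ∈ Finset.range k, PowerSeries.coeff l H * PowerSeries.coeff k (f ^ l) := by
  obtain ⟨h0, h1, -⟩ := hf
  rw [IsConjugacy, subst_eq_smul_iff h0]
  refine and_congr_right fun H0 => and_congr_right fun H1 => ⟨fun h k _ => ?_, fun h k => ?_⟩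
  · have := h k
    rw [Finset.sum_range_succ, coeff_pow_self h0, h1] at this
    linear_combination -this
  · rw [Finset.sum_range_succ, coeff_pow_self h0, h1]
    rcases k with _ | _ | k
    · simp [H0]
    · simp [H0, H1]
    · linear_combination -(h (k + 2) (by omega))

theorem mul_pow_sub_ne_zero (hlam : ‖lam‖ = 1) (hroot : ∀ n : ℕ, 1 ≤ n → lam ^ n ≠ 1) {k : ℕ}
    (hk : 2 ≤ k) : lam - lam ^ k ≠ 0 := by
  obtain ⟨n, rfl⟩ : ∃ n, k = n + 1 := ⟨k - 1, by omega⟩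
  have h0 : lam ≠ 0 := by
    rintro rfl
    simp at hlam
  intro h
  refine hroot n (by omega) (mul_left_cancel₀ h0 ?_)
  rw [← pow_succ']
  linear_combination -h

/-- The coefficients of the normalized formal conjugacy. -/
noncomputable def conjugacyCoeff (f : ℂ_[p]⟦X⟧) (lam : ℂ_[p]) : ℕ → ℂ_[p]
  | 0 => 0
  | 1 => 1
  | k + 2 => (∑ l : Fin (k + 2), conjugacyCoeff f lam l * PowerSeries.coeff (k + 2) (f ^ (l : ℕ))) /
      (lam - lam ^ (k + 2))

theorem existsUnique_isConjugacy (hlam : ‖lam‖ = 1) (hroot : ∀ n : ℕ, 1 ≤ n → lam ^ n ≠ 1)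
    (hf : f ∈ GFamily lam) : ∃! H : ℂ_[p]⟦X⟧, IsConjugacy f lam H := by
  refine ⟨PowerSeries.mk (conjugacyCoeff f lam), ?_, fun H hH => ?_⟩
  · dsimp only
    rw [isConjugacy_iff hf]
    simp only [PowerSeries.coeff_mk]
    refine ⟨by rw [conjugacyCoeff], by rw [conjugacyCoeff], fun k hk => ?_⟩
    obtain ⟨k, rfl⟩ : ∃ n, k = n + 2 := ⟨k - 2, by omega⟩
    rw [conjugacyCoeff, div_mul_cancel₀ _ (mul_pow_sub_ne_zero hlam hroot hk),
      Finset.sum_range fun l => conjugacyCoeff f lam l * PowerSeries.coeff (k + 2) (f ^ l)]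
  · replace hH := (isConjugacy_iff hf H).mp hH
    obtain ⟨H0, H1, hrec⟩ := hH
    ext k
    rw [PowerSeries.coeff_mk]
    induction k using Nat.strong_induction_on with
    | _ k ih =>
      rcases k with _ | _ | k
      · rw [H0, conjugacyCoeff]
      · rw [zero_add, H1, conjugacyCoeff]
      · rw [conjugacyCoeff, eq_div_iff (mul_pow_sub_ne_zero hlam hroot (by omega)),
          hrec _ (by omega),
          ← Finset.sum_range fun l => conjugacyCoeff f lam l * PowerSeries.coeff (k + 2) (f ^ l)]
        exact Finset.sum_congr rfl fun l hl => by rw [ih l (Finset.mem_range.mp hl)]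

theorem norm_one_sub_pow_le_one (hlam : ‖lam‖ = 1) (n : ℕ) : ‖1 - lam ^ n‖ ≤ 1 :=
  (norm_sub_le_max _ _).trans (by simp [hlam])

/-- Strong induction: the recursion bounds `|b_{k+2}| |1 - λ^(k+1)|` by some earlier `|b_l|`, and
the products decrease because every factor is at most 1. -/
theorem norm_coeff_conjugacy_mul_prod_le (hlam : ‖lam‖ = 1) (hf : f ∈ GFamily lam)
    {H : ℂ_[p]⟦X⟧} (hH : IsConjugacy f lam H) (k : ℕ) :
    ‖PowerSeries.coeff (k + 1) H‖ * ∏ n ∈ Finset.range k, ‖1 - lam ^ (n + 1)‖ ≤ 1 := by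
  obtain ⟨H0, H1, hrec⟩ := (isConjugacy_iff hf H).mp hH
  have hmono : ∀ i j : ℕ, i ≤ j → ∏ n ∈ Finset.range j, ‖1 - lam ^ (n + 1)‖ ≤
      ∏ n ∈ Finset.range i, ‖1 - lam ^ (n + 1)‖ := fun i j hij =>
    antitone_nat_of_succ_le (f := fun k => ∏ n ∈ Finset.range k, ‖1 - lam ^ (n + 1)‖) (fun n => by
      rw [Finset.prod_range_succ]
      exact mul_le_of_le_one_right (Finset.prod_nonneg fun _ _ => norm_nonneg _)
        (norm_one_sub_pow_le_one hlam _)) hij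
  induction k using Nat.strong_induction_on with
  | _ k ih =>
    rcases k with _ | k
    · simp [H1]
    have hsplit : lam - lam ^ (k + 1 + 1) = lam * (1 - lam ^ (k + 1)) := by ring
    have h := congrArg norm (hrec (k + 1 + 1) (by omega))
    rw [hsplit, norm_mul, norm_mul, hlam, one_mul] at h
    rw [Finset.prod_range_succ, mul_comm (∏ _ ∈ _, _), ← mul_assoc, h]
    set P := ∏ n ∈ Finset.range k, ‖1 - lam ^ (n + 1)‖ with hP
    have hP0 : 0 ≤ P := Finset.prod_nonneg fun _ _ => norm_nonneg _
    obtain ⟨i, hi, hle⟩ := IsUltrametricDist.exists_norm_finsetSum_le_of_nonempty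
      (t := Finset.range (k + 1 + 1)) (by simp)
      (fun l => PowerSeries.coeff l H * PowerSeries.coeff (k + 1 + 1) (f ^ l))
    refine (mul_le_mul_of_nonneg_right hle hP0).trans ?_
    rw [norm_mul]
    have h1 := norm_coeff_pow_le_one (GFamily.norm_coeff_le_one hlam hf) i (k + 1 + 1)
    rcases i with _ | i
    · simp [H0]
    have hi' : i ≤ k := by
      have := Finset.mem_range.mp hi
      omega
    calc ‖PowerSeries.coeff (i + 1) H‖ * ‖PowerSeries.coeff (k + 1 + 1) (f ^ (i + 1))‖ * P
        ≤ ‖PowerSeries.coeff (i + 1) H‖ * 1 * ∏ n ∈ Finset.range i, ‖1 - lam ^ (n + 1)‖ := by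
          gcongr
          exact hmono i k hi'
      _ ≤ 1 := by
          rw [mul_one]
          exact ih i (by omega)

theorem norm_value_le (hlam : ‖lam‖ = 1) (hf : f ∈ GFamily lam) {x : ℂ_[p]} (hx : ‖x‖ < 1) :
    ‖value f x‖ ≤ ‖x‖ := by
  refine IsUltrametricDist.norm_tsum_le_of_forall_le_of_nonneg (norm_nonneg _) fun k => ?_
  rcases k with _ | k
  · simp [hf.1]
  · rw [norm_mul, norm_pow]
    exact (mul_le_of_le_one_left (by positivity) (GFamily.norm_coeff_le_one hlam hf _)).trans
      (pow_le_of_le_one (norm_nonneg _) hx.le (by omega))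

theorem value_value (hlam : ‖lam‖ = 1) (hf : f ∈ GFamily lam) {H : ℂ_[p]⟦X⟧}
    (hH : IsConjugacy f lam H) {x : ℂ_[p]} (hx : ‖x‖ < 1) (hHx : ConvergesAt H x) :
    value H (value f x) = lam * value H x := by
  have h := tsum_comp hf.1 (GFamily.norm_coeff_le_one hlam hf) hx hHx
  rw [value, value, h, value, ← tsum_mul_left]
  refine tsum_congr fun k => ?_
  rw [(subst_eq_smul_iff hf.1 H).mp hH.2.2 k, mul_assoc]

/-- A disk on which the formal conjugacy converges and is tangent to the identity in the strong
sense is contained in the linearization disk. -/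
theorem subset_linearizationDisk (hlam : ‖lam‖ = 1) (hf : f ∈ GFamily lam) {H : ℂ_[p]⟦X⟧}
    (hH : IsConjugacy f lam H) {D : Set ℂ_[p]} (hdisk : IsDisk D) (hD1 : ∀ x ∈ D, ‖x‖ < 1)
    (hD : ∀ x ∈ D, ∀ y, ‖y‖ ≤ ‖x‖ → y ∈ D) (hsum : ∀ x ∈ D, ConvergesAt H x)
    (hc : ∀ x ∈ D, ∃ c < 1, ∀ k,
      ‖PowerSeries.coeff (k + 2) H‖ * ‖x‖ ^ (k + 1) ≤ c) :
    D ⊆ linearizationDisk f lam := by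
  refine Set.subset_sUnion_of_mem ⟨hdisk, fun x hx => ?_, fun x hx => ?_, H, D, hdisk, hsum, ?_,
    fun x hx => ?_⟩
  · exact (summable_norm_coeff_mul_pow (GFamily.norm_coeff_le_one hlam hf) (hD1 x hx)).of_norm
  · exact hD x hx _ (norm_value_le hlam hf (hD1 x hx))
  · exact bijOn_tsum hH.1 hH.2.1 hD hsum hc
  · exact value_value hlam hf hH (hD1 x hx) (hsum x hx)

end Conjugacy

/-! ### The radii `R(s)`. -/

section Radii

variable (p : ℕ) [Fact p.Prime]

theorem one_lt_natCast_prime : (1 : ℝ) < p := by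
  exact_mod_cast (Fact.out : p.Prime).one_lt

theorem R_succ_pos (s : ℕ) : 0 < R p (s + 1) := by
  have := one_lt_natCast_prime p
  rw [R]
  positivity

theorem R_nonneg (s : ℕ) : 0 ≤ R p s := by
  rcases s with _ | s
  · rw [R]
  · exact (R_succ_pos p s).le

theorem R_strictMono : StrictMono (R p) := by
  refine strictMono_nat_of_lt_succ fun s => ?_
  have hp := one_lt_natCast_prime p
  have h1 : 0 < (p : ℝ) - 1 := by linarith
  rcases s with _ | s
  · rw [R]
    exact R_succ_pos p 0
  · rw [R, R]
    refine Real.rpow_lt_rpow_of_exponent_lt hp ?_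
    rw [neg_lt_neg_iff]
    exact one_div_lt_one_div_of_lt (by positivity)
      (mul_lt_mul_of_pos_right (pow_lt_pow_right₀ hp (Nat.lt_succ_self s)) h1)

theorem R_succ_pow (s : ℕ) : R p (s + 1) ^ (p ^ s * (p - 1)) = (p : ℝ)⁻¹ := by
  have hp := one_lt_natCast_prime p
  have h1 : 0 < (p : ℝ) - 1 := by linarith
  rw [R, ← Real.rpow_mul_natCast (by positivity), Nat.cast_mul, Nat.cast_pow,
    Nat.cast_sub (Fact.out : p.Prime).one_le, Nat.cast_one, neg_mul,
    one_div_mul_cancel (by positivity), Real.rpow_neg_one]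

theorem tendsto_R : Filter.Tendsto (R p) Filter.atTop (nhds 1) := by
  rw [← Filter.tendsto_add_atTop_iff_nat 1]
  have hp := one_lt_natCast_prime p
  have h1 : 0 < (p : ℝ) - 1 := by linarith
  have h2 : Filter.Tendsto (fun s : ℕ => -(1 / ((p : ℝ) ^ s * ((p : ℝ) - 1)))) Filter.atTop
      (nhds (-0)) := by
    refine Filter.Tendsto.neg (Filter.Tendsto.div_atTop tendsto_const_nhds ?_)
    exact (tendsto_pow_atTop_atTop_of_one_lt hp).atTop_mul_const h1
  have h3 := (tendsto_const_nhds (x := (p : ℝ))).rpow h2 (Or.inl (by positivity))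
  rw [neg_zero, Real.rpow_zero] at h3
  exact h3

theorem norm_natCast_prime : ‖(p : ℂ_[p])‖ = (p : ℝ)⁻¹ := by
  have h := PadicComplex.norm_extends' p (p : ℚ_[p])
  rw [Padic.norm_p] at h
  rw [← h]
  congr 1
  simp

end Radii

/-! ### Distances to `p`-power roots of unity and bounds for `|1 - μ^(p^j)|`. -/

section RootsOfUnity

variable {p : ℕ} [Fact p.Prime]

theorem exists_isPrimitiveRoot (i : ℕ) : ∃ ζ : ℂ_[p], IsPrimitiveRoot ζ (p ^ i) := by
  have : NeZero p := ⟨(Fact.out : p.Prime).ne_zero⟩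
  exact HasEnoughRootsOfUnity.exists_primitiveRoot ℂ_[p] (p ^ i)

theorem norm_eq_one_of_pow_prime_pow_eq_one {ζ : ℂ_[p]} {i : ℕ} (h : ζ ^ p ^ i = 1) : ‖ζ‖ = 1 := by
  refine (pow_eq_one_iff_of_nonneg (norm_nonneg ζ)
    (pow_ne_zero i (Fact.out : p.Prime).ne_zero)).mp ?_
  rw [← norm_pow, h, norm_one]

theorem norm_one_sub_pow_le {x : ℂ_[p]} (hx : ‖x‖ ≤ 1) (n : ℕ) : ‖1 - x ^ n‖ ≤ ‖1 - x‖ := by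
  rcases n with _ | n
  · simp
  · have h := norm_pow_sub_pow_le (x := (1 : ℂ_[p])) (y := x) (by simpa using hx) n
    simpa using h

/-- This is `|Φ_{p^(i+1)}(1)| = |p|`. -/
theorem prod_norm_one_sub_primitiveRoots (i : ℕ) :
    ∏ η ∈ primitiveRoots (p ^ (i + 1)) ℂ_[p], ‖1 - η‖ = (p : ℝ)⁻¹ := by
  obtain ⟨ζ, hζ⟩ := exists_isPrimitiveRoot (p := p) (i + 1)
  have h := congrArg (Polynomial.eval 1) (Polynomial.cyclotomic_eq_prod_X_sub_primitiveRoots hζ)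
  rw [Polynomial.eval_one_cyclotomic_prime_pow, Polynomial.eval_prod] at h
  rw [← norm_natCast_prime, h, norm_prod]
  simp

/-- Primitive roots are powers of one another, so all lie at the same distance from 1; the product
of the `p^i (p - 1)` distances is `1/p`. -/
theorem norm_one_sub_primitiveRoot {ζ : ℂ_[p]} {i : ℕ} (hζ : IsPrimitiveRoot ζ (p ^ (i + 1))) :
    ‖1 - ζ‖ = R p (i + 1) := by
  have hp : p.Prime := Fact.out
  have heq : ∀ η ∈ primitiveRoots (p ^ (i + 1)) ℂ_[p], ‖1 - η‖ = ‖1 - ζ‖ := by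
    intro η hη
    have hη' := isPrimitiveRoot_of_mem_primitiveRoots hη
    have : NeZero (p ^ (i + 1)) := ⟨pow_ne_zero _ hp.ne_zero⟩
    obtain ⟨a, -, ha⟩ := hζ.eq_pow_of_pow_eq_one hη'.pow_eq_one
    obtain ⟨c, -, hc⟩ := hη'.eq_pow_of_pow_eq_one hζ.pow_eq_one
    apply le_antisymm
    · rw [← ha]
      exact norm_one_sub_pow_le (norm_eq_one_of_pow_prime_pow_eq_one hζ.pow_eq_one).le a
    · conv_lhs => rw [← hc]
      exact norm_one_sub_pow_le (norm_eq_one_of_pow_prime_pow_eq_one hη'.pow_eq_one).le c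
  have h := prod_norm_one_sub_primitiveRoots (p := p) i
  rw [Finset.prod_congr rfl heq, Finset.prod_const, hζ.card_primitiveRoots,
    Nat.totient_prime_pow_succ hp, ← R_succ_pow p i] at h
  have hp1 := hp.one_lt
  exact (pow_left_inj₀ (norm_nonneg _) (R_nonneg p _)
    (mul_ne_zero (pow_ne_zero _ hp.ne_zero) (by omega))).mp h

theorem norm_one_sub_le_R {ζ : ℂ_[p]} {i : ℕ} (h : ζ ^ p ^ i = 1) : ‖1 - ζ‖ ≤ R p i := by
  obtain ⟨k, hk, hord⟩ := (Nat.dvd_prime_pow Fact.out).mp (orderOf_dvd_of_pow_eq_one h)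
  have hprim := IsPrimitiveRoot.orderOf ζ
  rw [hord] at hprim
  rcases k with _ | k
  · rw [pow_zero, IsPrimitiveRoot.one_right_iff] at hprim
    simp [hprim, R_nonneg]
  · rw [norm_one_sub_primitiveRoot hprim]
    exact (R_strictMono p).monotone hk

theorem pow_eq_one_of_norm_one_sub_lt_R {ζ : ℂ_[p]} (hζ : ζ ∈ GammaR p) {s : ℕ}
    (h : ‖1 - ζ‖ < R p (s + 1)) : ζ ^ p ^ s = 1 := by
  obtain ⟨i, hi⟩ := hζ
  obtain ⟨k, hk, hord⟩ := (Nat.dvd_prime_pow Fact.out).mp (orderOf_dvd_of_pow_eq_one hi)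
  have hprim := IsPrimitiveRoot.orderOf ζ
  rw [hord] at hprim
  rcases le_or_gt k s with hks | hks
  · exact hprim.pow_eq_one_iff_dvd _ |>.mpr (pow_dvd_pow p hks)
  · obtain ⟨k, rfl⟩ : ∃ n, k = n + 1 := ⟨k - 1, by omega⟩
    rw [norm_one_sub_primitiveRoot hprim] at h
    exact absurd h (not_lt.mpr ((R_strictMono p).monotone hks))

theorem pow_le_norm_one_sub_pow {x : ℂ_[p]} {c : ℝ} (hc : 0 ≤ c) {j : ℕ}
    (h : ∀ ζ : ℂ_[p], ζ ^ p ^ j = 1 → c ≤ ‖x - ζ‖) : c ^ p ^ j ≤ ‖1 - x ^ p ^ j‖ := by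
  have hpos : 0 < p ^ j := pow_pos (Fact.out : p.Prime).pos _
  obtain ⟨ζ, hζ⟩ := exists_isPrimitiveRoot (p := p) j
  have hprod := congrArg (Polynomial.eval x) (Polynomial.X_pow_sub_one_eq_prod hpos hζ)
  rw [Polynomial.eval_prod] at hprod
  simp only [Polynomial.eval_sub, Polynomial.eval_pow, Polynomial.eval_X, Polynomial.eval_one,
    Polynomial.eval_C] at hprod
  rw [norm_sub_rev, hprod, norm_prod]
  conv_lhs => rw [← hζ.card_nthRootsFinset, ← Finset.prod_const]
  refine Finset.prod_le_prod (fun _ _ => hc) fun η hη => h η ?_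
  exact (Polynomial.mem_nthRootsFinset hpos 1).mp hη

/-- The lower bound for `|1 - μ ^ p ^ j|` at levels below `s`. -/
theorem pow_norm_le_norm_one_sub_pow {μ : ℂ_[p]} {s j : ℕ} (hs : R p s ≤ ‖1 - μ‖) (hj : j < s) :
    ‖1 - μ‖ ^ p ^ j ≤ ‖1 - μ ^ p ^ j‖ := by
  refine pow_le_norm_one_sub_pow (norm_nonneg _) fun ζ hζ => ?_
  have h1 : ‖1 - ζ‖ < ‖1 - μ‖ :=
    ((norm_one_sub_le_R hζ).trans_lt (R_strictMono p hj)).trans_le hs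
  have h2 : ‖1 - μ‖ ≤ max ‖1 - ζ‖ ‖μ - ζ‖ := by
    have h := norm_sub_le_max (1 - ζ) (μ - ζ)
    rwa [sub_sub_sub_cancel_right] at h
  exact (le_max_iff.mp h2).resolve_left (not_le.mpr h1)

/-- The lower bound for `|1 - μ ^ p ^ j|` at levels from `t` on. -/
theorem pow_mul_pow_le_norm_one_sub_pow {μ γ₀ : ℂ_[p]} (hγ₀ : γ₀ ∈ GammaR p)
    (hmin : ∀ γ ∈ GammaR p, ‖γ₀ - μ‖ ≤ ‖γ - μ‖) {t j : ℕ} (htj : t ≤ j)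
    (hj : γ₀ ^ p ^ j = 1) :
    ‖γ₀ - μ‖ ^ p ^ t * (p : ℝ)⁻¹ ^ (j - t) ≤ ‖1 - μ ^ p ^ j‖ := by
  have hnorm : ‖γ₀‖ = 1 := norm_eq_one_of_pow_prime_pow_eq_one hj
  have hne : γ₀ ≠ 0 := by
    rintro rfl
    simp at hnorm
  -- Dividing by `γ₀` permutes the group and makes 1 a closest root, leaving the `p^j`-th power
  -- unchanged.
  set ν := μ / γ₀ with hν
  have hμ : μ ^ p ^ j = ν ^ p ^ j := by rw [hν, div_pow, hj, div_one]
  have hlow : ∀ η ∈ GammaR p, ‖γ₀ - μ‖ ≤ ‖ν - η‖ := by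
    rintro η ⟨i, hi⟩
    obtain ⟨k, hk⟩ := hγ₀
    have hmem : γ₀ * η ∈ GammaR p := by
      refine ⟨k + i, ?_⟩
      rw [mul_pow, pow_add, pow_mul, hk, one_pow, one_mul, mul_comm, pow_mul, hi, one_pow]
    refine (hmin _ hmem).trans_eq ?_
    have : γ₀ * η - μ = γ₀ * (η - ν) := by rw [hν]; field_simp
    rw [this, norm_mul, hnorm, one_mul, norm_sub_rev]
  have h1ν : ‖1 - ν‖ = ‖γ₀ - μ‖ := by
    have : γ₀ - μ = γ₀ * (1 - ν) := by rw [hν]; field_simp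
    rw [this, norm_mul, hnorm, one_mul]
  rw [hμ]
  -- The bound for `ν` holds from level `t` on, even where `γ₀^(p^j) ≠ 1`, so the induction must not
  -- carry that hypothesis.
  clear hj hμ
  induction j, htj using Nat.le_induction with
  | base =>
    rw [Nat.sub_self, pow_zero, mul_one]
    exact pow_le_norm_one_sub_pow (norm_nonneg _) fun ζ hζ => hlow ζ ⟨t, hζ⟩
  | succ j htj ih =>
    obtain ⟨ζ, hζ⟩ := exists_isPrimitiveRoot (p := p) (j + 1)
    have h := congrArg (Polynomial.eval ν)
      (Polynomial.cyclotomic_prime_pow_mul_X_pow_sub_one ℂ_[p] p j)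
    rw [Polynomial.cyclotomic_eq_prod_X_sub_primitiveRoots hζ, Polynomial.eval_mul,
      Polynomial.eval_prod] at h
    simp only [Polynomial.eval_sub, Polynomial.eval_pow, Polynomial.eval_X, Polynomial.eval_one,
      Polynomial.eval_C] at h
    rw [norm_sub_rev 1, ← h, norm_mul, norm_prod, norm_sub_rev (ν ^ p ^ j),
      Nat.succ_sub htj, pow_succ, ← mul_assoc, mul_comm]
    refine mul_le_mul ?_ ih (by positivity) (Finset.prod_nonneg fun _ _ => norm_nonneg _)
    -- As 1 is closest to `ν`, `|1 - η| ≤ |ν - η|` for each primitive `η`, so the new cyclotomic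
    -- factor is at least `1/p`.
    rw [← prod_norm_one_sub_primitiveRoots (p := p) j]
    refine Finset.prod_le_prod (fun _ _ => norm_nonneg _) fun η hη => ?_
    have hη' := hlow η ⟨j + 1, (isPrimitiveRoot_of_mem_primitiveRoots hη).pow_eq_one⟩
    have h2 := norm_sub_le_max (1 - ν) (η - ν)
    rw [sub_sub_sub_cancel_right, h1ν, norm_sub_rev η] at h2
    exact h2.trans (max_le hη' le_rfl)

end RootsOfUnity

/-! ### Summing the level exponents over `a ≤ N`. -/

section LevelSums

/-- The exponents `e j` with `p ^ (-e j)` a lower bound for `|1 - μ ^ p ^ j|`, in terms of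
`L = -log_p |1 - μ|` and `D = -log_p |γ₀ - μ|`. -/
noncomputable def levelExponent (p s t : ℕ) (L D : ℝ) (j : ℕ) : ℝ :=
  if j < s then (p : ℝ) ^ j * L else (j - t) + (p : ℝ) ^ t * D

variable {p : ℕ} [Fact p.Prime]

/-- Only the jump at `s` needs an argument: `1 / (p - 1)` separates the two regimes. -/
theorem levelExponent_monotone {s t : ℕ} {L D : ℝ} (hts : t ≤ s) (hL0 : 0 ≤ L)
    (hL : ∀ i, s = i + 1 → (p : ℝ) ^ i * L ≤ 1 / ((p : ℝ) - 1))
    (hD : 1 / ((p : ℝ) - 1) ≤ (p : ℝ) ^ t * D) : Monotone (levelExponent p s t L D) := by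
  have hp := one_lt_natCast_prime p
  have hts' : (t : ℝ) ≤ s := by exact_mod_cast hts
  refine monotone_nat_of_le_succ fun j => ?_
  unfold levelExponent
  split_ifs with h1 h2 h2
  · exact mul_le_mul_of_nonneg_right (pow_le_pow_right₀ hp.le (Nat.le_succ j)) hL0
  · have hs : s = j + 1 := by omega
    have := hL j hs
    subst hs
    linarith
  · omega
  · push_cast
    linarith

/-- Write `e(v_p(a))` as a telescoping sum and exchange sums: the increment at `j` is counted `⌊N /
p^(j+1)⌋` times. Monotonicity allows dropping the floor. -/
theorem sum_padicValNat_le {e : ℕ → ℝ} (he : Monotone e) {N B : ℕ} (hB : N < p ^ (B + 1)) :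
    ∑ a ∈ Finset.Ioc 0 N, e (padicValNat p a) ≤
      N * (e 0 + ∑ j ∈ Finset.range B, (e (j + 1) - e j) / (p : ℝ) ^ (j + 1)) := by
  have hp : p.Prime := Fact.out
  have hp' := one_lt_natCast_prime p
  have h1 : ∀ a ∈ Finset.Ioc 0 N, e (padicValNat p a) =
      e 0 + ∑ j ∈ Finset.range B, if p ^ (j + 1) ∣ a then e (j + 1) - e j else 0 := by
    intro a ha
    obtain ⟨ha0, haN⟩ := Finset.mem_Ioc.mp ha
    have hv : padicValNat p a ≤ B := by
      have h : p ^ padicValNat p a < p ^ (B + 1) :=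
        (Nat.le_of_dvd ha0 pow_padicValNat_dvd).trans_lt (haN.trans_lt hB)
      exact Nat.lt_succ_iff.mp ((Nat.pow_lt_pow_iff_right hp.one_lt).mp h)
    have h2 : ∀ j ∈ Finset.range B, (if p ^ (j + 1) ∣ a then e (j + 1) - e j else 0) =
        if j < padicValNat p a then e (j + 1) - e j else 0 := by
      intro j _
      congr 1
      rw [padicValNat_dvd_iff_le ha0.ne']
      exact propext Nat.succ_le_iff
    rw [Finset.sum_congr rfl h2, ← Finset.sum_filter]
    have h3 : (Finset.range B).filter (· < padicValNat p a) = Finset.range (padicValNat p a) := by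
      ext j
      simp only [Finset.mem_filter, Finset.mem_range]
      omega
    rw [h3, Finset.sum_range_sub]
    ring
  rw [Finset.sum_congr rfl h1, Finset.sum_add_distrib, Finset.sum_const, Nat.card_Ioc,
    Nat.sub_zero, nsmul_eq_mul, mul_add, Finset.sum_comm, Finset.mul_sum]
  refine add_le_add_right (Finset.sum_le_sum fun j _ => ?_) _
  rw [← Finset.sum_filter, Finset.sum_const, Nat.Ioc_filter_dvd_card_eq_div, nsmul_eq_mul,
    mul_div_assoc', mul_comm, mul_comm (N : ℝ), mul_div_assoc]
  refine mul_le_mul_of_nonneg_left ?_ (sub_nonneg.mpr (he (Nat.le_succ j)))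
  have := Nat.cast_div_le (α := ℝ) (m := N) (n := p ^ (j + 1))
  simpa using this

theorem levelExponent_sum_of_lt {s t : ℕ} {L D : ℝ} {B : ℕ} (hB : B < s) :
    levelExponent p s t L D 0 + ∑ j ∈ Finset.range B,
      (levelExponent p s t L D (j + 1) - levelExponent p s t L D j) / (p : ℝ) ^ (j + 1) =
      L + B * L * (((p : ℝ) - 1) / p) := by
  have hp := one_lt_natCast_prime p
  induction B with
  | zero => simp [levelExponent, hB]
  | succ B ih =>
    rw [Finset.sum_range_succ, ← add_assoc, ih (by omega), levelExponent, levelExponent, if_pos hB,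
      if_pos (by omega)]
    push_cast
    field_simp
    ring

/-- Past level `s` the increments are 1 and the tail is geometric. The subtracted last term is the
slack behind the later strict inequality. -/
theorem levelExponent_sum {s t : ℕ} {L D : ℝ} (hts : t ≤ s) (i : ℕ) :
    levelExponent p s t L D 0 + ∑ j ∈ Finset.range (s + i),
      (levelExponent p s t L D (j + 1) - levelExponent p s t L D j) / (p : ℝ) ^ (j + 1) =
      s * L * (((p : ℝ) - 1) / p) + (s - t) / (p : ℝ) ^ s + (p : ℝ) ^ t / (p : ℝ) ^ s * D +
        1 / ((p : ℝ) ^ s * (p - 1)) - 1 / ((p : ℝ) ^ (s + i) * (p - 1)) := by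
  have hp := one_lt_natCast_prime p
  have hp1 : (p : ℝ) - 1 ≠ 0 := by linarith
  have hp0 : (p : ℝ) ≠ 0 := by positivity
  induction i with
  | zero =>
    rcases s with _ | s
    · obtain rfl : t = 0 := by omega
      simp [levelExponent]
    · rw [add_zero, Finset.sum_range_succ, ← add_assoc, levelExponent_sum_of_lt (by omega),
        levelExponent, levelExponent, if_neg (by omega), if_pos (by omega)]
      push_cast
      field_simp
      ring
  | succ i ih =>
    rw [← add_assoc, Finset.sum_range_succ, ← add_assoc, ih, levelExponent, levelExponent,
      if_neg (by omega), if_neg (by omega)]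
    push_cast
    field_simp
    ring

end LevelSums

/-! ### Reduction of `|1 - λ^n|` to `p`-power exponents. -/

section PowerNorms

variable {p : ℕ} [Fact p.Prime]

theorem norm_natCast_of_not_dvd {u : ℕ} (hu : ¬ p ∣ u) : ‖(u : ℂ_[p])‖ = 1 := by
  have h := PadicComplex.norm_extends' p (u : ℚ_[p])
  have h2 : ‖(u : ℚ_[p])‖ = 1 := by
    rw [Padic.norm_natCast_eq_one_iff]
    exact (Nat.Prime.coprime_iff_not_dvd Fact.out).mpr hu
  rw [h2] at h
  rw [← h]
  congr 1
  simp

/-- The cofactor `1 + x + ... + x^(u-1)` is congruent to the unit `u` modulo `1 - x`. -/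
theorem norm_one_sub_le_of_not_dvd {x : ℂ_[p]} (hx : ‖x‖ = 1) (hx1 : ‖1 - x‖ < 1) {u : ℕ}
    (hu : ¬ p ∣ u) : ‖1 - x‖ ≤ ‖1 - x ^ u‖ := by
  have h1 : ‖(u : ℂ_[p]) - ∑ i ∈ Finset.range u, x ^ i‖ ≤ ‖1 - x‖ := by
    have : (u : ℂ_[p]) - ∑ i ∈ Finset.range u, x ^ i = ∑ i ∈ Finset.range u, (1 - x ^ i) := by
      simp
    rw [this]
    exact IsUltrametricDist.norm_sum_le_of_forall_le_of_nonneg (norm_nonneg _) fun i _ =>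
      norm_one_sub_pow_le hx.le i
  have h2 : 1 ≤ ‖∑ i ∈ Finset.range u, x ^ i‖ := by
    have h := norm_sub_le_max ((u : ℂ_[p]) - ∑ i ∈ Finset.range u, x ^ i)
      (-∑ i ∈ Finset.range u, x ^ i)
    rw [sub_neg_eq_add, sub_add_cancel, norm_natCast_of_not_dvd hu, norm_neg] at h
    exact (le_max_iff.mp h).resolve_left (not_le.mpr (h1.trans_lt hx1))
  rw [← mul_neg_geom_sum, norm_mul]
  exact le_mul_of_one_le_right (norm_nonneg _) h2

theorem norm_one_sub_pow_of_not_dvd {lam : ℂ_[p]} (hlam : ‖lam‖ = 1) {m : ℕ}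
    (hm : IsLeast {n : ℕ | 1 ≤ n ∧ ‖1 - lam ^ n‖ < 1} m) {n : ℕ} (hn : ¬ m ∣ n) :
    1 ≤ ‖1 - lam ^ n‖ := by
  by_contra! hlt
  obtain ⟨⟨hm1, hmlt⟩, hleast⟩ := hm
  have hr : ‖1 - lam ^ (n % m)‖ < 1 := by
    have hsplit : lam ^ n - lam ^ (n % m) = -(lam ^ (n % m) * (1 - (lam ^ m) ^ (n / m))) := by
      have h : lam ^ n = lam ^ (n % m) * (lam ^ m) ^ (n / m) := by
        rw [← pow_mul, ← pow_add, Nat.mod_add_div]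
      rw [h]
      ring
    have h1 : ‖lam ^ n - lam ^ (n % m)‖ < 1 := by
      rw [hsplit, norm_neg, norm_mul, norm_pow, hlam, one_pow, one_mul]
      exact (norm_one_sub_pow_le (by rw [norm_pow, hlam, one_pow]) _).trans_lt hmlt
    have h2 := IsUltrametricDist.norm_add_le_max (1 - lam ^ n) (lam ^ n - lam ^ (n % m))
    rw [sub_add_sub_cancel] at h2
    exact h2.trans_lt (max_lt hlt h1)
  have hpos : 1 ≤ n % m := Nat.pos_of_ne_zero fun h => hn (Nat.dvd_of_mod_eq_zero h)
  have := hleast ⟨hpos, hr⟩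
  have := Nat.mod_lt n hm1
  omega

end PowerNorms

/-! ### The small divisor product against powers of `r̃(λ)`. -/

section Multiplier

variable {p : ℕ} [Fact p.Prime] {lam : ℂ_[p]} {m s t : ℕ} {γ₀ : ℂ_[p]}

theorem IsMultiplierData.dist_le (hd : IsMultiplierData lam m s t γ₀) :
    ‖γ₀ - lam ^ m‖ ≤ ‖1 - lam ^ m‖ := hd.γ₀_min 1 ⟨0, one_pow _⟩

theorem IsMultiplierData.t_le_s (hd : IsMultiplierData lam m s t γ₀) : t ≤ s := by
  have h := (hd.t_bounds.1.trans hd.dist_le).trans_lt hd.s_bounds.2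
  exact Nat.lt_succ_iff.mp ((R_strictMono p).lt_iff_lt.mp h)

theorem IsMultiplierData.γ₀_pow (hd : IsMultiplierData lam m s t γ₀) : γ₀ ^ p ^ s = 1 := by
  refine pow_eq_one_of_norm_one_sub_lt_R hd.γ₀_mem ?_
  have h := norm_sub_le_max (1 - lam ^ m) (γ₀ - lam ^ m)
  rw [sub_sub_sub_cancel_right] at h
  exact (h.trans (max_le le_rfl hd.dist_le)).trans_lt hd.s_bounds.2

theorem IsMultiplierData.norm_one_sub_pos (hd : IsMultiplierData lam m s t γ₀)
    (hroot : ∀ n : ℕ, 1 ≤ n → lam ^ n ≠ 1) : 0 < ‖1 - lam ^ m‖ :=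
  norm_pos_iff.mpr (sub_ne_zero.mpr (hroot m hd.m_least.1.1).symm)

theorem IsMultiplierData.dist_pos (hd : IsMultiplierData lam m s t γ₀)
    (hroot : ∀ n : ℕ, 1 ≤ n → lam ^ n ≠ 1) : 0 < ‖γ₀ - lam ^ m‖ := by
  refine norm_pos_iff.mpr (sub_ne_zero.mpr fun h => ?_)
  have h1 := hd.γ₀_pow
  rw [h, ← pow_mul] at h1
  exact hroot _ (Nat.mul_pos hd.m_least.1.1 (pow_pos (Fact.out : p.Prime).pos s)) h1

/-- `L = -log_p |1 - λ ^ m|`. -/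
noncomputable def logDistOne (lam : ℂ_[p]) (m : ℕ) : ℝ := -Real.logb p ‖1 - lam ^ m‖

/-- `D = -log_p |γ₀ - λ ^ m|`. -/
noncomputable def logDistRoot (lam : ℂ_[p]) (m : ℕ) (γ₀ : ℂ_[p]) : ℝ :=
  -Real.logb p ‖γ₀ - lam ^ m‖

theorem rpow_neg_logDistOne (hd : IsMultiplierData lam m s t γ₀)
    (hroot : ∀ n : ℕ, 1 ≤ n → lam ^ n ≠ 1) :
    (p : ℝ) ^ (-logDistOne lam m) = ‖1 - lam ^ m‖ := by
  have hp := one_lt_natCast_prime p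
  rw [logDistOne, neg_neg, Real.rpow_logb (by positivity) hp.ne' (hd.norm_one_sub_pos hroot)]

theorem rpow_neg_logDistRoot (hd : IsMultiplierData lam m s t γ₀)
    (hroot : ∀ n : ℕ, 1 ≤ n → lam ^ n ≠ 1) :
    (p : ℝ) ^ (-logDistRoot lam m γ₀) = ‖γ₀ - lam ^ m‖ := by
  have hp := one_lt_natCast_prime p
  rw [logDistRoot, neg_neg, Real.rpow_logb (by positivity) hp.ne' (hd.dist_pos hroot)]

theorem logDistOne_pos (hd : IsMultiplierData lam m s t γ₀)
    (hroot : ∀ n : ℕ, 1 ≤ n → lam ^ n ≠ 1) : 0 < logDistOne lam m := by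
  have hp := one_lt_natCast_prime p
  rw [logDistOne, neg_pos]
  exact Real.logb_neg hp (hd.norm_one_sub_pos hroot) hd.m_least.1.2

theorem pow_mul_logDistOne_le (hd : IsMultiplierData lam m s t γ₀)
    (hroot : ∀ n : ℕ, 1 ≤ n → lam ^ n ≠ 1) (i : ℕ) (hi : s = i + 1) :
    (p : ℝ) ^ i * logDistOne lam m ≤ 1 / ((p : ℝ) - 1) := by
  have hp := one_lt_natCast_prime p
  have hp1 : 0 < (p : ℝ) - 1 := by linarith
  have hp0 : 0 < (p : ℝ) := by linarith
  have h := hd.s_bounds.1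
  rw [hi, R, ← rpow_neg_logDistOne hd hroot, Real.rpow_le_rpow_left_iff hp, neg_le_neg_iff,
    le_div_iff₀ (by positivity)] at h
  rw [le_div_iff₀ hp1]
  linarith

theorem le_pow_mul_logDistRoot (hd : IsMultiplierData lam m s t γ₀)
    (hroot : ∀ n : ℕ, 1 ≤ n → lam ^ n ≠ 1) :
    1 / ((p : ℝ) - 1) ≤ (p : ℝ) ^ t * logDistRoot lam m γ₀ := by
  have hp := one_lt_natCast_prime p
  have hp1 : 0 < (p : ℝ) - 1 := by linarith
  have hp0 : 0 < (p : ℝ) := by linarith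
  have h := hd.t_bounds.2.le
  rw [R, ← rpow_neg_logDistRoot hd hroot, Real.rpow_le_rpow_left_iff hp, neg_le_neg_iff,
    div_le_iff₀ (by positivity)] at h
  rw [div_le_iff₀ hp1]
  linarith

/-- The exponent `W` with `r̃(λ) ^ m = p ^ (-W)`. -/
noncomputable def radiusExponent (p s t : ℕ) (L D : ℝ) : ℝ :=
  s * L * (((p : ℝ) - 1) / p) + (s - t) / (p : ℝ) ^ s + (p : ℝ) ^ t / (p : ℝ) ^ s * D +
    1 / ((p : ℝ) ^ s * (p - 1))

theorem radiusExponent_pos (hd : IsMultiplierData lam m s t γ₀)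
    (hroot : ∀ n : ℕ, 1 ≤ n → lam ^ n ≠ 1) :
    0 < radiusExponent p s t (logDistOne lam m) (logDistRoot lam m γ₀) := by
  have hp := one_lt_natCast_prime p
  have hp1 : 0 < (p : ℝ) - 1 := by linarith
  have hp0 : 0 < (p : ℝ) := by linarith
  have hts : 0 ≤ (s : ℝ) - t := sub_nonneg.mpr (by exact_mod_cast hd.t_le_s)
  have hL := logDistOne_pos hd hroot
  have hD : 0 ≤ (p : ℝ) ^ t * logDistRoot lam m γ₀ :=
    le_trans (by positivity) (le_pow_mul_logDistRoot hd hroot)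
  have hD' : 0 ≤ (p : ℝ) ^ t / (p : ℝ) ^ s * logDistRoot lam m γ₀ := by
    rw [div_mul_eq_mul_div]
    positivity
  unfold radiusExponent
  positivity

theorem rTilde_eq (hd : IsMultiplierData lam m s t γ₀)
    (hroot : ∀ n : ℕ, 1 ≤ n → lam ^ n ≠ 1) :
    rTilde lam m s t γ₀ =
      (p : ℝ) ^ (-(radiusExponent p s t (logDistOne lam m) (logDistRoot lam m γ₀) / m)) := by
  have hp := one_lt_natCast_prime p
  have hp1 : 0 < (p : ℝ) - 1 := by linarith
  have hp0 : 0 < (p : ℝ) := by linarith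
  have hm : (m : ℝ) ≠ 0 := Nat.cast_ne_zero.mpr (Nat.one_le_iff_ne_zero.mp hd.m_least.1.1)
  rw [rTilde, R, ← rpow_neg_logDistOne hd hroot, ← rpow_neg_logDistRoot hd hroot,
    ← Real.rpow_mul hp0.le, ← Real.rpow_mul hp0.le, ← Real.rpow_mul hp0.le, ← Real.rpow_add hp0,
    ← Real.rpow_add hp0, ← Real.rpow_add hp0, Real.rpow_sub hp0, Real.rpow_natCast,
    Real.rpow_natCast]
  congr 1
  unfold radiusExponent
  field_simp
  ring

theorem rpow_neg_levelExponent_le (hd : IsMultiplierData lam m s t γ₀)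
    (hroot : ∀ n : ℕ, 1 ≤ n → lam ^ n ≠ 1) (j : ℕ) :
    (p : ℝ) ^ (-levelExponent p s t (logDistOne lam m) (logDistRoot lam m γ₀) j) ≤
      ‖1 - (lam ^ m) ^ p ^ j‖ := by
  have hp0 : 0 < (p : ℝ) := by linarith [one_lt_natCast_prime p]
  unfold levelExponent
  split_ifs with hj
  · refine le_trans (le_of_eq ?_) (pow_norm_le_norm_one_sub_pow hd.s_bounds.1 hj)
    rw [← rpow_neg_logDistOne hd hroot, ← Real.rpow_mul_natCast hp0.le]
    push_cast
    congr 1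
    ring
  · rw [not_lt] at hj
    have htj := hd.t_le_s.trans hj
    have hγ : γ₀ ^ p ^ j = 1 := by
      rw [← Nat.add_sub_cancel' hj, pow_add, pow_mul, hd.γ₀_pow, one_pow]
    refine le_trans (le_of_eq ?_) (pow_mul_pow_le_norm_one_sub_pow hd.γ₀_mem hd.γ₀_min htj hγ)
    rw [← rpow_neg_logDistRoot hd hroot, ← Real.rpow_mul_natCast hp0.le, ← Real.rpow_neg_one,
      ← Real.rpow_mul_natCast hp0.le, ← Real.rpow_add hp0, Nat.cast_sub htj]
    push_cast
    congr 1
    ring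

theorem rpow_neg_levelExponent_padicValNat_le (hlam : ‖lam‖ = 1)
    (hd : IsMultiplierData lam m s t γ₀) (hroot : ∀ n : ℕ, 1 ≤ n → lam ^ n ≠ 1) {a : ℕ}
    (ha : a ≠ 0) :
    (p : ℝ) ^ (-levelExponent p s t (logDistOne lam m) (logDistRoot lam m γ₀) (padicValNat p a)) ≤
      ‖1 - lam ^ (m * a)‖ := by
  have hμ : ‖lam ^ m‖ = 1 := by rw [norm_pow, hlam, one_pow]
  obtain ⟨u, hu⟩ := pow_padicValNat_dvd (p := p) (n := a)
  have hpu : ¬ p ∣ u := by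
    rintro ⟨c, rfl⟩
    refine pow_succ_padicValNat_not_dvd (p := p) ha ⟨c, ?_⟩
    rw [pow_succ, mul_assoc]
    exact hu
  refine (rpow_neg_levelExponent_le hd hroot _).trans ?_
  have h := norm_one_sub_le_of_not_dvd (x := (lam ^ m) ^ p ^ padicValNat p a)
    (by rw [norm_pow, hμ, one_pow])
    ((norm_one_sub_pow_le hμ.le _).trans_lt hd.m_least.1.2) hpu
  rwa [← pow_mul _ _ u, ← hu, ← pow_mul lam m a] at h

theorem rpow_neg_sum_le_prod (hlam : ‖lam‖ = 1) (hd : IsMultiplierData lam m s t γ₀)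
    (hroot : ∀ n : ℕ, 1 ≤ n → lam ^ n ≠ 1) (k : ℕ) :
    (p : ℝ) ^ (-∑ a ∈ Finset.Ioc 0 (k / m),
      levelExponent p s t (logDistOne lam m) (logDistRoot lam m γ₀) (padicValNat p a)) ≤
      ∏ n ∈ Finset.range k, ‖1 - lam ^ (n + 1)‖ := by
  have hp0 : 0 < (p : ℝ) := by linarith [one_lt_natCast_prime p]
  induction k with
  | zero => simp
  | succ k ih =>
    rw [Finset.prod_range_succ, Nat.succ_div]
    split_ifs with hdvd
    · have hk : k + 1 = m * (k / m + 1) := by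
        have h := Nat.mul_div_cancel' hdvd
        rw [Nat.succ_div_of_dvd hdvd] at h
        exact h.symm
      rw [← Finset.insert_Ioc_right_eq_Ioc_add_one (Nat.zero_le _), Finset.sum_insert (by simp),
        neg_add, add_comm, Real.rpow_add hp0]
      refine mul_le_mul ih ?_ (by positivity) (Finset.prod_nonneg fun _ _ => norm_nonneg _)
      conv_rhs => rw [hk]
      exact rpow_neg_levelExponent_padicValNat_le hlam hd hroot (Nat.succ_ne_zero _)
    · rw [add_zero]
      exact ih.trans (le_mul_of_one_le_right (Finset.prod_nonneg fun _ _ => norm_nonneg _)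
        (norm_one_sub_pow_of_not_dvd hlam hd.m_least hdvd))

theorem sum_levelExponent_lt (hd : IsMultiplierData lam m s t γ₀)
    (hroot : ∀ n : ℕ, 1 ≤ n → lam ^ n ≠ 1) {N : ℕ} (hN : N ≠ 0) :
    ∑ a ∈ Finset.Ioc 0 N,
      levelExponent p s t (logDistOne lam m) (logDistRoot lam m γ₀) (padicValNat p a) <
      N * radiusExponent p s t (logDistOne lam m) (logDistRoot lam m γ₀) := by
  have hp := one_lt_natCast_prime p
  have hp1 : 0 < (p : ℝ) - 1 := by linarith
  have hmono := levelExponent_monotone hd.t_le_s (logDistOne_pos hd hroot).le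
    (pow_mul_logDistOne_le hd hroot) (le_pow_mul_logDistRoot hd hroot)
  -- Taking `B = s + N` covers every valuation up to `N` and fits the closed form at `i = N`.
  have hB : N < p ^ (s + N + 1) :=
    (Nat.lt_pow_self (Fact.out : p.Prime).one_lt).trans_le
      (Nat.pow_le_pow_right (Fact.out : p.Prime).pos (by omega))
  refine (sum_padicValNat_le hmono hB).trans_lt ?_
  rw [levelExponent_sum hd.t_le_s]
  refine mul_lt_mul_of_pos_left ?_ (by exact_mod_cast Nat.pos_of_ne_zero hN)
  unfold radiusExponent
  have : 0 < 1 / ((p : ℝ) ^ (s + N) * (p - 1)) := by positivity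
  linarith

theorem norm_coeff_mul_rTilde_pow_lt (hlam : ‖lam‖ = 1) (hd : IsMultiplierData lam m s t γ₀)
    (hroot : ∀ n : ℕ, 1 ≤ n → lam ^ n ≠ 1) {f H : ℂ_[p]⟦X⟧} (hf : f ∈ GFamily lam)
    (hH : IsConjugacy f lam H) (k : ℕ) :
    ‖PowerSeries.coeff (k + 2) H‖ * rTilde lam m s t γ₀ ^ (k + 1) < 1 := by
  have hp := one_lt_natCast_prime p
  have hp0 : 0 < (p : ℝ) := by linarith
  have hm : 0 < m := hd.m_least.1.1
  have hm' : (0 : ℝ) < m := by exact_mod_cast hm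
  set W := radiusExponent p s t (logDistOne lam m) (logDistRoot lam m γ₀) with hW
  have hWpos : 0 < W := radiusExponent_pos hd hroot
  have hlt : (∑ a ∈ Finset.Ioc 0 ((k + 1) / m),
      levelExponent p s t (logDistOne lam m) (logDistRoot lam m γ₀) (padicValNat p a)) <
      (k + 1 : ℕ) * (W / m) := by
    -- Below degree `m` the sum is empty, and strictness comes from `W > 0` instead.
    rcases Nat.eq_zero_or_pos ((k + 1) / m) with h0 | h0
    · rw [h0]
      simp only [Finset.Ioc_self, Finset.sum_empty]
      positivity
    · refine (sum_levelExponent_lt hd hroot h0.ne').trans_le ?_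
      have h1 : (((k + 1) / m : ℕ) : ℝ) ≤ ((k + 1 : ℕ) : ℝ) / m := Nat.cast_div_le
      calc (((k + 1) / m : ℕ) : ℝ) * W ≤ ((k + 1 : ℕ) : ℝ) / m * W := by gcongr
        _ = _ := by ring
  have h1 : rTilde lam m s t γ₀ ^ (k + 1) < ∏ n ∈ Finset.range (k + 1), ‖1 - lam ^ (n + 1)‖ := by
    refine lt_of_lt_of_le ?_ (rpow_neg_sum_le_prod hlam hd hroot (k + 1))
    rw [rTilde_eq hd hroot, ← Real.rpow_mul_natCast hp0.le]
    refine Real.rpow_lt_rpow_of_exponent_lt hp ?_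
    rw [← hW]
    linarith
  have h2 := norm_coeff_conjugacy_mul_prod_le hlam hf hH (k + 1)
  rcases (norm_nonneg (PowerSeries.coeff (k + 2) H)).eq_or_lt with h0 | h0
  · rw [← h0, zero_mul]
    exact one_pos
  · exact (mul_lt_mul_of_pos_left h1 h0).trans_le h2

theorem rTilde_pos (hd : IsMultiplierData lam m s t γ₀)
    (hroot : ∀ n : ℕ, 1 ≤ n → lam ^ n ≠ 1) : 0 < rTilde lam m s t γ₀ := by
  rw [rTilde_eq hd hroot]
  exact Real.rpow_pos_of_pos (by linarith [one_lt_natCast_prime p]) _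

theorem rTilde_lt_one (hd : IsMultiplierData lam m s t γ₀)
    (hroot : ∀ n : ℕ, 1 ≤ n → lam ^ n ≠ 1) : rTilde lam m s t γ₀ < 1 := by
  rw [rTilde_eq hd hroot]
  refine Real.rpow_lt_one_of_one_lt_of_neg (one_lt_natCast_prime p) ?_
  have hm : (0 : ℝ) < m := by exact_mod_cast hd.m_least.1.1
  rw [neg_lt_zero]
  exact div_pos (radiusExponent_pos hd hroot) hm

end Multiplier

/-! ### Existence of `m`, `s`, `t` and `γ₀`. -/

section Existence

variable {p : ℕ} [Fact p.Prime]

/-- Two powers of an algebraic element of norm `≤ 1` are at distance `< 1`, by compactness of the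
unit ball of `ℚ_p[α]`. -/
theorem exists_pow_sub_pow_norm_lt_one {α : PadicAlgCl p} (hα : ‖α‖ ≤ 1) :
    ∃ i j : ℕ, i < j ∧ ‖α ^ i - α ^ j‖ < 1 := by
  set V : Submodule ℚ_[p] (PadicAlgCl p) :=
    Subalgebra.toSubmodule (Algebra.adjoin ℚ_[p] {α}) with hV
  have hfin : FiniteDimensional ℚ_[p] V := Module.Finite.iff_fg.mpr
    (IsIntegral.fg_adjoin_singleton (Algebra.IsIntegral.isIntegral α))
  have hproper : ProperSpace V := FiniteDimensional.proper ℚ_[p] V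
  let u : ℕ → V := fun n => ⟨α ^ n, pow_mem (Algebra.self_mem_adjoin_singleton ℚ_[p] α) n⟩
  have hu : ∀ n, u n ∈ Metric.closedBall (0 : V) 1 := by
    intro n
    rw [mem_closedBall_zero_iff]
    change ‖α ^ n‖ ≤ 1
    rw [norm_pow]
    exact pow_le_one₀ (norm_nonneg _) hα
  obtain ⟨a, -, φ, hφ, hlim⟩ := (isCompact_closedBall (0 : V) 1).tendsto_subseq hu
  obtain ⟨N, hN⟩ := Metric.cauchySeq_iff.mp hlim.cauchySeq 1 one_pos
  refine ⟨φ N, φ (N + 1), hφ (Nat.lt_succ_self N), ?_⟩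
  have h := hN N le_rfl (N + 1) (Nat.le_succ N)
  rw [dist_eq_norm] at h
  exact h

theorem exists_norm_one_sub_pow_lt_one {lam : ℂ_[p]} (hlam : ‖lam‖ = 1) :
    ∃ n : ℕ, 1 ≤ n ∧ ‖1 - lam ^ n‖ < 1 := by
  -- An algebraic `α` within distance 1 of `λ` has powers congruent to those of `λ`, so a
  -- near-coincidence of its powers transfers.
  obtain ⟨α, hα⟩ := (UniformSpace.Completion.denseRange_coe (α := PadicAlgCl p)).exists_dist_lt
    lam one_pos
  rw [dist_eq_norm] at hα
  have hα1 : ‖(α : ℂ_[p])‖ ≤ 1 := by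
    have h := norm_sub_le_max lam (lam - α)
    rw [sub_sub_cancel, hlam] at h
    exact h.trans (max_le le_rfl hα.le)
  obtain ⟨i, j, hij, h⟩ := exists_pow_sub_pow_norm_lt_one (α := α)
    (by rwa [PadicComplex.norm_extends] at hα1)
  rw [← PadicComplex.norm_extends] at h
  have hcoe : ((α ^ i - α ^ j : PadicAlgCl p) : ℂ_[p]) = (α : ℂ_[p]) ^ i - (α : ℂ_[p]) ^ j := by
    simp only [PadicComplex.coe_eq, map_sub, map_pow]
  rw [hcoe] at h
  have hpow : ∀ n, ‖lam ^ n - (α : ℂ_[p]) ^ n‖ < 1 := by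
    rintro (_ | n)
    · simp
    · refine (norm_pow_sub_pow_le (by rwa [hlam]) n).trans_lt ?_
      rwa [hlam, one_pow, one_mul]
  refine ⟨j - i, by omega, ?_⟩
  have hsplit : lam ^ i * (1 - lam ^ (j - i)) =
      (lam ^ i - (α : ℂ_[p]) ^ i) + (((α : ℂ_[p]) ^ i - (α : ℂ_[p]) ^ j) -
        (lam ^ j - (α : ℂ_[p]) ^ j)) := by
    rw [mul_sub, ← pow_add, Nat.add_sub_cancel' hij.le]
    ring
  have hnorm : ‖1 - lam ^ (j - i)‖ = ‖lam ^ i * (1 - lam ^ (j - i))‖ := by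
    rw [norm_mul, norm_pow, hlam, one_pow, one_mul]
  rw [hnorm, hsplit]
  refine (IsUltrametricDist.norm_add_le_max _ _).trans_lt (max_lt (hpow i) ?_)
  exact (norm_sub_le_max _ _).trans_lt (max_lt h (hpow j))

theorem exists_R_le_and_lt {x : ℝ} (h0 : 0 ≤ x) (h1 : x < 1) :
    ∃ s, R p s ≤ x ∧ x < R p (s + 1) := by
  classical
  have hex : ∃ s, x < R p (s + 1) := by
    obtain ⟨s, hs⟩ := ((tendsto_R p).eventually_const_lt h1).exists
    exact ⟨s, hs.trans (R_strictMono p (Nat.lt_succ_self s))⟩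
  refine ⟨Nat.find hex, ?_, Nat.find_spec hex⟩
  rcases hs : Nat.find hex with _ | s
  · rwa [R]
  · exact not_lt.mp (Nat.find_min hex (m := s) (by omega))

theorem exists_isMultiplierData {lam : ℂ_[p]} (hlam : ‖lam‖ = 1) :
    ∃ (m s t : ℕ) (γ₀ : ℂ_[p]), IsMultiplierData lam m s t γ₀ := by
  classical
  have hex := exists_norm_one_sub_pow_lt_one hlam
  set m := Nat.find hex with hm
  have hmlt := (Nat.find_spec hex).2
  rw [← hm] at hmlt
  obtain ⟨s, hs1, hs2⟩ := exists_R_le_and_lt (p := p) (norm_nonneg (1 - lam ^ m)) hmlt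
  have hpos : 0 < p ^ s := pow_pos (Fact.out : p.Prime).pos s
  obtain ⟨γ₀, hγ₀, hmin⟩ := (Polynomial.nthRootsFinset (p ^ s) (1 : ℂ_[p])).exists_min_image
    (fun γ => ‖γ - lam ^ m‖) ⟨1, (Polynomial.mem_nthRootsFinset hpos 1).mpr (one_pow _)⟩
  have h1 : ‖γ₀ - lam ^ m‖ ≤ ‖1 - lam ^ m‖ :=
    hmin 1 ((Polynomial.mem_nthRootsFinset hpos 1).mpr (one_pow _))
  obtain ⟨t, ht⟩ := exists_R_le_and_lt (p := p) (norm_nonneg (γ₀ - lam ^ m)) (h1.trans_lt hmlt)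
  refine ⟨m, s, t, γ₀, ⟨Nat.find_spec hex, fun n hn => Nat.find_min' hex hn⟩, ⟨hs1, hs2⟩,
    ⟨s, (Polynomial.mem_nthRootsFinset hpos 1).mp hγ₀⟩, fun γ hγ => ?_, ht⟩
  by_cases hγs : γ ^ p ^ s = 1
  · exact hmin γ ((Polynomial.mem_nthRootsFinset hpos 1).mpr hγs)
  · have h2 : R p (s + 1) ≤ ‖1 - γ‖ := by
      by_contra! hlt
      exact hγs (pow_eq_one_of_norm_one_sub_lt_R hγ hlt)
    have h3 := norm_sub_le_max (1 - lam ^ m) (γ - lam ^ m)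
    rw [sub_sub_sub_cancel_right] at h3
    rcases le_max_iff.mp h3 with h4 | h4
    · exact absurd (h2.trans h4) (not_le.mpr hs2)
    · exact h1.trans (hs2.le.trans (h2.trans h4))

end Existence

/-! ### From coefficient bounds to convergence and contraction. -/

section Disks

theorem exists_lt_one_forall_le {a : ℕ → ℝ} (ha : ∀ k, a k < 1)
    (hlim : Filter.Tendsto a Filter.atTop (nhds 0)) : ∃ c < 1, ∀ k, a k ≤ c := by
  obtain ⟨K, hK⟩ := Filter.eventually_atTop.mp (hlim.eventually_lt_const (one_half_pos (α := ℝ)))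
  have hfin : ∀ n : ℕ, ∃ c < 1, ∀ k < n, a k ≤ c := by
    intro n
    induction n with
    | zero => exact ⟨0, one_pos, fun k hk => absurd hk (Nat.not_lt_zero k)⟩
    | succ n ih =>
      obtain ⟨c, hc, hcn⟩ := ih
      refine ⟨max c (a n), max_lt hc (ha n), fun k hk => ?_⟩
      rcases Nat.lt_succ_iff_lt_or_eq.mp hk with h | rfl
      · exact (hcn k h).trans (le_max_left _ _)
      · exact le_max_right _ _
  obtain ⟨c, hc, hcK⟩ := hfin K
  refine ⟨max c (1 / 2), max_lt hc one_half_lt_one, fun k => ?_⟩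
  rcases lt_or_ge k K with h | h
  · exact (hcK k h).trans (le_max_left _ _)
  · exact (hK k h).le.trans (le_max_right _ _)

variable {p : ℕ} [Fact p.Prime] {H : ℂ_[p]⟦X⟧} {r : ℝ}

theorem norm_coeff_mul_pow_le (hH : ∀ k, ‖PowerSeries.coeff (k + 2) H‖ * r ^ (k + 1) < 1)
    (hr : 0 < r) (x : ℂ_[p]) (k : ℕ) :
    ‖PowerSeries.coeff (k + 2) H‖ * ‖x‖ ^ (k + 1) ≤ (‖x‖ / r) ^ (k + 1) := by
  calc ‖PowerSeries.coeff (k + 2) H‖ * ‖x‖ ^ (k + 1)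
      = ‖PowerSeries.coeff (k + 2) H‖ * r ^ (k + 1) * (‖x‖ / r) ^ (k + 1) := by
        rw [div_pow]; field_simp
    _ ≤ 1 * (‖x‖ / r) ^ (k + 1) := by gcongr; exact (hH k).le
    _ = _ := one_mul _

theorem convergesAt_of_norm_lt (hH : ∀ k, ‖PowerSeries.coeff (k + 2) H‖ * r ^ (k + 1) < 1)
    {x : ℂ_[p]} (hx : ‖x‖ < r) : ConvergesAt H x := by
  have hr : 0 < r := (norm_nonneg x).trans_lt hx
  refine (summable_nat_add_iff 2).mp (Summable.of_norm_bounded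
    (g := fun k => ‖x‖ / r * ‖x‖ * (‖x‖ / r) ^ k) ?_ fun k => ?_)
  · exact (summable_geometric_of_lt_one (by positivity) ((div_lt_one hr).mpr hx)).mul_left _
  · rw [norm_mul, norm_pow]
    calc ‖PowerSeries.coeff (k + 2) H‖ * ‖x‖ ^ (k + 2)
        = ‖PowerSeries.coeff (k + 2) H‖ * ‖x‖ ^ (k + 1) * ‖x‖ := by ring
      _ ≤ (‖x‖ / r) ^ (k + 1) * ‖x‖ := by
        gcongr; exact norm_coeff_mul_pow_le hH hr x k
      _ = _ := by ring

theorem exists_bound_of_norm_lt (hH : ∀ k, ‖PowerSeries.coeff (k + 2) H‖ * r ^ (k + 1) < 1)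
    {x : ℂ_[p]} (hx : ‖x‖ < r) :
    ∃ c < 1, ∀ k, ‖PowerSeries.coeff (k + 2) H‖ * ‖x‖ ^ (k + 1) ≤ c := by
  have hr : 0 < r := (norm_nonneg x).trans_lt hx
  refine ⟨‖x‖ / r, (div_lt_one hr).mpr hx, fun k => (norm_coeff_mul_pow_le hH hr x k).trans ?_⟩
  exact pow_le_of_le_one (by positivity) ((div_lt_one hr).mpr hx).le (Nat.succ_ne_zero k)

/-- On the boundary circle geometric decay is lost; convergence makes the terms tend to 0, so strict
termwise bounds become uniform. -/
theorem exists_bound_of_convergesAt (hH : ∀ k, ‖PowerSeries.coeff (k + 2) H‖ * r ^ (k + 1) < 1)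
    (hr : 0 < r) {x : ℂ_[p]} (hx : ‖x‖ = r) (hHx : ConvergesAt H x) :
    ∃ c < 1, ∀ k, ‖PowerSeries.coeff (k + 2) H‖ * ‖x‖ ^ (k + 1) ≤ c := by
  refine exists_lt_one_forall_le (fun k => by rw [hx]; exact hH k) ?_
  have h := ((summable_nat_add_iff 2).mpr hHx).tendsto_atTop_zero.norm.mul_const r⁻¹
  rw [norm_zero, zero_mul] at h
  refine h.congr fun k => ?_
  rw [norm_mul, norm_pow, hx, pow_succ r (k + 1)]
  field_simp

end Disks

end PadicLin

theorem theoremA (p : ℕ) [Fact p.Prime] (lam : ℂ_[p]) (hlam : ‖lam‖ = 1)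
    (hroot : ∀ n : ℕ, 1 ≤ n → lam ^ n ≠ 1) :
    (∃ (m s t : ℕ) (γ₀ : ℂ_[p]), PadicLin.IsMultiplierData lam m s t γ₀) ∧
    ∀ f ∈ PadicLin.GFamily lam,
      (∃! H : PowerSeries ℂ_[p], PadicLin.IsConjugacy f lam H) ∧
      ∀ (m s t : ℕ) (γ₀ : ℂ_[p]), PadicLin.IsMultiplierData lam m s t γ₀ →
        ENNReal.ofReal (PadicLin.rTilde lam m s t γ₀) ≤ PadicLin.linearizationRadius f lam ∧
        Metric.ball 0 (PadicLin.rTilde lam m s t γ₀) ⊆ PadicLin.linearizationDisk f lam ∧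
        ∀ H : PowerSeries ℂ_[p], PadicLin.IsConjugacy f lam H →
          (∀ x ∈ Metric.closedBall (0 : ℂ_[p]) (PadicLin.rTilde lam m s t γ₀),
            PadicLin.ConvergesAt H x) →
          Metric.closedBall 0 (PadicLin.rTilde lam m s t γ₀) ⊆
            PadicLin.linearizationDisk f lam := by
  open PadicLin in
  refine ⟨exists_isMultiplierData hlam, fun f hf =>
    ⟨existsUnique_isConjugacy hlam hroot hf, fun m s t γ₀ hd => ?_⟩⟩
  have hr := rTilde_pos hd hroot
  have hr1 := rTilde_lt_one hd hroot
  have hball : Metric.ball 0 (rTilde lam m s t γ₀) ⊆ linearizationDisk f lam := by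
    obtain ⟨H, hH, -⟩ := existsUnique_isConjugacy hlam hroot hf
    have hb := norm_coeff_mul_rTilde_pow_lt hlam hd hroot hf hH
    refine subset_linearizationDisk hlam hf hH ⟨_, hr, Or.inl rfl⟩ (fun x hx => ?_)
      (fun x hx y hy => ?_) (fun x hx => ?_) (fun x hx => ?_)
    all_goals rw [mem_ball_zero_iff] at hx
    · exact hx.trans hr1
    · exact mem_ball_zero_iff.mpr (hy.trans_lt hx)
    · exact convergesAt_of_norm_lt hb hx
    · exact exists_bound_of_norm_lt hb hx
  refine ⟨le_sSup ⟨_, hr, hball, rfl⟩, hball, fun H hH hconv => ?_⟩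
  have hb := norm_coeff_mul_rTilde_pow_lt hlam hd hroot hf hH
  refine subset_linearizationDisk hlam hf hH ⟨_, hr, Or.inr rfl⟩ (fun x hx => ?_)
    (fun x hx y hy => ?_) hconv (fun x hx => ?_)
  · exact (mem_closedBall_zero_iff.mp hx).trans_lt hr1
  · exact mem_closedBall_zero_iff.mpr (hy.trans (mem_closedBall_zero_iff.mp hx))
  · rcases (mem_closedBall_zero_iff.mp hx).lt_or_eq with h | h
    · exact exists_bound_of_norm_lt hb h
    · exact exists_bound_of_convergesAt hb hr h (hconv x hx)
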